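/- Let $\mathbb{F}_q$ be a finite field with $q$ elements. On the set $T=\mathbb{F}_q(x)\setminus\mathbb{F}_q$ of nonconstant rational functions consider the composition $(g\circ h)(x)=g(h(x))$, with neutral element $x$. Call $f\in T$ \emph{indecomposable} if it is not a unit for composition and, whenever $f=g\circ h$ with $g,h\in T$, at least one of $g,h$ is a unit for composition. A \emph{complete decomposition} of $f\in T$ of length $r$ is an expression $f=g_1\circ\cdots\circ g_r$ with every $g_i\in T$ indecomposable. Let $$P_q=(x^q-x)^{q-1}\in\mathbb{F}_q[x].$$ Then: 1. $P_q$ has two complete decompositions of different lengths if and only if $q$ is not prime. 2. If $q$ is prime, every complete decomposition of $P_q$ has length exactly $\Omega(q-1)+1$, where $\Omega(n)$ is the number of prime factors of $n$ counted with multiplicity. (Equivalently, if $P_q=g_1\circ\cdots\circ g_r$ is a complete decomposition, the chain of right components $x,\ g_r,\ g_{r-1}\circ g_r,\ \ldots,\ g_1\circ\cdots\circ g_r=P_q$, with both ends included, has $\Omega(q-1)+2$ terms.) -/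

import Mathlib

namespace RatDecomp

variable {K : Type*} [Field K]

/-- Composition `g ∘ h = g(h(x))` of rational functions: substitute `h` for the variable of `g`.
It is only used for nonconstant `h`, where the denominator of `g` does not vanish at `h`. -/
noncomputable def comp (g h : RatFunc K) : RatFunc K :=
  RatFunc.eval RatFunc.C h g

/-- `f` lies in `T = K(x) \ K`. -/
def IsNonconst (f : RatFunc K) : Prop :=
  ∀ c : K, f ≠ RatFunc.C c

/-- `u` is a unit of the semigroup `(T, ∘)`, whose neutral element is `x`. -/
def IsCompUnit (u : RatFunc K) : Prop :=
  IsNonconst u ∧ ∃ v : RatFunc K, IsNonconst v ∧ comp u v = RatFunc.X ∧ comp v u = RatFunc.X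

/-- `f ∈ T` is indecomposable: it is not a unit, and every decomposition `f = g ∘ h` in `T`
is trivial, that is, has a unit among its two components. -/
def IsIndecomposable (f : RatFunc K) : Prop :=
  IsNonconst f ∧ ¬ IsCompUnit f ∧
    ∀ g h : RatFunc K, IsNonconst g → IsNonconst h → f = comp g h →
      IsCompUnit g ∨ IsCompUnit h

/-- The composite `g₁ ∘ (g₂ ∘ ⋯ ∘ g_r)` of a list `[g₁, …, g_r]`; it is `x` for the empty list. -/
noncomputable def compList (l : List (RatFunc K)) : RatFunc K :=
  l.foldr comp RatFunc.X

/-- `[g₁, …, g_r]` is a complete decomposition of `f`: `f = g₁ ∘ ⋯ ∘ g_r` with every `g_i`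
indecomposable. Its length is the number `r` of components. -/
def IsCompleteDecomposition (f : RatFunc K) (l : List (RatFunc K)) : Prop :=
  (∀ g ∈ l, IsIndecomposable g) ∧ f = compList l

/-- For a finite field `F` with `q` elements, `P_q = (x^q - x)^(q-1)`. -/
noncomputable def polyP (F : Type*) [Field F] [Fintype F] : RatFunc F :=
  (RatFunc.X ^ Fintype.card F - RatFunc.X) ^ (Fintype.card F - 1)

end RatDecomp

/-! Inserting a Möbius unit and its inverse turns any decomposition of a polynomial into one with
polynomial components (`exists_polynomial_decomposition`), so the problem is about polynomials.

For `q` prime, the polynomial right components `H` of `P_q = (x^q - x)^(q-1)` are, up to a linear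
polynomial on the left, exactly of the forms `(x - b)^d` or `(x^q - x)^d` with `d ∣ q - 1`
(`right_component_classification`). Indeed every fibre of `H` meeting `F` lies in `F`, with one
ramification index dividing `q - 1`. If `q` divides `deg H`, a single fibre fills `F`. Otherwise
`H'` divides `P_q' = (x^q - x)^(q-2)`, and a Riemann–Hurwitz count leaves only one ramified fibre, a
single point. A complete decomposition is thus a chain through these shapes. Within either family an
indecomposable step multiplies `d` by a prime; exactly one step crosses from `(x - b)^d` to `(x^q -
x)^d`, keeping `d`; no step goes back. The length is `Ω(q - 1) + 1`.

For `q` not prime, `P_q = (x(x-1)^(q-1)) ∘ x^(q-1) = x^(q-1) ∘ (x^q - x)`. In the first form the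
extra factor is indecomposable. In the second, `x^q - x` itself decomposes through `x^p - x`, so the
extra factor contributes at least two components. -/

namespace RatDecomp

open Polynomial

/-! ### The composition semigroup, its units, and detecting polynomials -/

section Composition

variable {K : Type*} [Field K]

theorem IsNonconst.eval₂_ne_zero {h : RatFunc K} (hh : IsNonconst h) {p : K[X]} (hp : p ≠ 0) :
    p.eval₂ RatFunc.C h ≠ 0 := by
  have ht : Transcendental K h := RatFunc.transcendental_of_ne_C h (by
    rintro ⟨c, hc⟩; exact hh c hc)
  exact fun h0 => hp ((transcendental_iff.mp ht) p h0)

/-- Composition on the right with a nonconstant function, as a ring homomorphism. -/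
noncomputable def compHom (h : RatFunc K) (hh : IsNonconst h) : RatFunc K →+* RatFunc K where
  toFun g := comp g h
  map_one' := RatFunc.eval_one _ _
  map_zero' := RatFunc.eval_zero _ _
  map_mul' x y := RatFunc.eval_mul _ _ (hh.eval₂_ne_zero x.denom_ne_zero)
    (hh.eval₂_ne_zero y.denom_ne_zero)
  map_add' x y := RatFunc.eval_add _ _ (hh.eval₂_ne_zero x.denom_ne_zero)
    (hh.eval₂_ne_zero y.denom_ne_zero)

theorem compHom_apply {h : RatFunc K} (hh : IsNonconst h) (g : RatFunc K) :
    compHom h hh g = comp g h := rfl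

@[simp]
theorem comp_algebraMap (p : K[X]) (h : RatFunc K) :
    comp (algebraMap K[X] (RatFunc K) p) h = aeval h p := by
  rw [comp, RatFunc.eval_algebraMap]; rfl

@[simp]
theorem comp_C (c : K) (h : RatFunc K) : comp (RatFunc.C c) h = RatFunc.C c :=
  RatFunc.eval_C _ _

@[simp]
theorem X_comp (h : RatFunc K) : comp RatFunc.X h = h := RatFunc.eval_X _ _

theorem comp_eq_div (g h : RatFunc K) : comp g h = aeval h g.num / aeval h g.denom := rfl

@[simp]
theorem comp_X (g : RatFunc K) : comp g RatFunc.X = g := by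
  rw [comp_eq_div, RatFunc.aeval_X_left_eq_algebraMap, RatFunc.aeval_X_left_eq_algebraMap,
    RatFunc.num_div_denom]

theorem aeval_algebraMap_eq_comp (p q : K[X]) :
    aeval (algebraMap K[X] (RatFunc K) q) p = algebraMap K[X] (RatFunc K) (p.comp q) := by
  rw [aeval_algebraMap_apply, aeval_def, Polynomial.comp]; rfl

/-- Substitution of a nonconstant function is a homomorphism out of a field. This right cancellation
is what later pins down left components. -/
theorem comp_left_injective {h : RatFunc K} (hh : IsNonconst h) {g g' : RatFunc K}
    (e : comp g h = comp g' h) : g = g' :=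
  (compHom h hh).injective e

theorem IsNonconst.comp {g h : RatFunc K} (hg : IsNonconst g) (hh : IsNonconst h) :
    IsNonconst (comp g h) := fun c e =>
  hg c (comp_left_injective hh (by rw [e, comp_C]))

theorem comp_assoc (g h : RatFunc K) {k : RatFunc K} (hk : IsNonconst k) :
    comp (comp g h) k = comp g (comp h k) := by
  have key : ∀ p : K[X], comp (aeval h p) k = aeval (comp h k) p := fun p => by
    have := Polynomial.hom_eval₂ p RatFunc.C (compHom k hk) h
    rw [compHom_apply] at this
    rw [aeval_def, aeval_def, RatFunc.algebraMap_eq_C, this, compHom_apply]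
    congr 1
    ext c
    exact comp_C c k
  rw [comp_eq_div g h, ← compHom_apply hk, map_div₀, compHom_apply, compHom_apply, key, key,
    comp_eq_div g]

theorem isNonconst_algebraMap {p : K[X]} (hp : p.natDegree ≠ 0) :
    IsNonconst (algebraMap K[X] (RatFunc K) p) := by
  intro c e
  rw [← RatFunc.algebraMap_C] at e
  rw [RatFunc.algebraMap_injective K e] at hp
  simp at hp

theorem natDegree_ne_zero_of_isNonconst {p : K[X]}
    (hp : IsNonconst (algebraMap K[X] (RatFunc K) p)) : p.natDegree ≠ 0 := by
  intro e
  rw [natDegree_eq_zero] at e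
  obtain ⟨c, rfl⟩ := e
  exact hp c (RatFunc.algebraMap_C c)

theorem isNonconst_X : IsNonconst (RatFunc.X : RatFunc K) := by
  rw [← RatFunc.algebraMap_X]; exact isNonconst_algebraMap (by simp)

/-- `u` and `v` are mutually inverse for composition. -/
def Inverses (u v : RatFunc K) : Prop :=
  IsNonconst u ∧ IsNonconst v ∧ comp u v = RatFunc.X ∧ comp v u = RatFunc.X

theorem isCompUnit_iff {u : RatFunc K} : IsCompUnit u ↔ ∃ v, Inverses u v :=
  ⟨fun ⟨a, v, b, c⟩ => ⟨v, a, b, c⟩, fun ⟨v, a, b, c⟩ => ⟨a, v, b, c⟩⟩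

namespace Inverses

theorem symm {u v : RatFunc K} (h : Inverses u v) : Inverses v u :=
  ⟨h.2.1, h.1, h.2.2.2, h.2.2.1⟩

theorem isCompUnit {u v : RatFunc K} (h : Inverses u v) : IsCompUnit u :=
  isCompUnit_iff.mpr ⟨v, h⟩

theorem comp_cancel {u v f : RatFunc K} (h : Inverses u v) (hf : IsNonconst f) :
    comp u (comp v f) = f := by
  rw [← comp_assoc u _ hf, h.2.2.1, X_comp]

theorem cancel_comp {u v : RatFunc K} (f : RatFunc K) (h : Inverses u v) :
    comp (comp f u) v = f := by
  rw [comp_assoc f _ h.2.1, h.2.2.1, comp_X]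

theorem comp {u v u' v' : RatFunc K} (h : Inverses u v) (h' : Inverses u' v') :
    Inverses (comp u u') (RatDecomp.comp v' v) := by
  refine ⟨h.1.comp h'.1, h'.2.1.comp h.2.1, ?_, ?_⟩
  · rw [comp_assoc _ _ (h'.2.1.comp h.2.1), h'.comp_cancel h.2.1, h.2.2.1]
  · rw [comp_assoc _ _ (h.1.comp h'.1), h.symm.comp_cancel h'.1, h'.2.2.2]

theorem refl : Inverses (RatFunc.X : RatFunc K) RatFunc.X :=
  ⟨isNonconst_X, isNonconst_X, X_comp _, X_comp _⟩

end Inverses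

theorem IsCompUnit.comp {u v : RatFunc K} (hu : IsCompUnit u) (hv : IsCompUnit v) :
    IsCompUnit (comp u v) := by
  obtain ⟨u', hu⟩ := isCompUnit_iff.mp hu
  obtain ⟨v', hv⟩ := isCompUnit_iff.mp hv
  exact (hu.comp hv).isCompUnit

/-- Indecomposability is invariant under units on both sides. -/
theorem IsIndecomposable.conj {g u u' v v' : RatFunc K} (hg : IsIndecomposable g)
    (hu : Inverses u u') (hv : Inverses v v') : IsIndecomposable (comp u (comp g v)) := by
  have key : ∀ f, f = comp u (comp g v) → g = comp u' (comp f v') := by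
    rintro f rfl
    rw [comp_assoc u _ hv.2.1, hv.cancel_comp, hu.symm.comp_cancel hg.1]
  refine ⟨hu.1.comp (hg.1.comp hv.1), fun h => hg.2.1 ?_, fun a b ha hb e => ?_⟩
  · rw [key _ rfl]
    exact hu.symm.isCompUnit.comp (h.comp hv.symm.isCompUnit)
  · have e' : g = comp (comp u' a) (comp b v') := by
      rw [key _ rfl, e, comp_assoc a _ hv.2.1, comp_assoc u' _ (hb.comp hv.2.1)]
    rcases hg.2.2 _ _ (hu.2.1.comp ha) (hb.comp hv.2.1) e' with h | h
    · left
      rw [← hu.comp_cancel ha]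
      exact hu.isCompUnit.comp h
    · right
      rw [← hv.symm.cancel_comp b]
      exact h.comp hv.isCompUnit

theorem isCompUnit_algebraMap {p : K[X]} (hp : p.natDegree = 1) :
    IsCompUnit (algebraMap K[X] (RatFunc K) p) := by
  obtain ⟨a, ha, b, rfl⟩ : ∃ a : K, a ≠ 0 ∧ ∃ b : K, p = C a * X + C b := by
    refine ⟨p.coeff 1, ?_, p.coeff 0, p.eq_X_add_C_of_natDegree_le_one hp.le⟩
    rw [← hp]; exact leadingCoeff_ne_zero.mpr (by rintro rfl; simp at hp)
  refine ⟨isNonconst_algebraMap (by omega), algebraMap K[X] _ (C a⁻¹ * (X - C b)),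
    isNonconst_algebraMap ?_, ?_, ?_⟩
  · rw [natDegree_C_mul (inv_ne_zero ha)]; simp
  · rw [comp_algebraMap, aeval_algebraMap_eq_comp, ← RatFunc.algebraMap_X]
    congr 1
    simp only [add_comp, mul_comp, C_comp, Polynomial.X_comp]
    rw [← mul_assoc, ← C_mul, mul_inv_cancel₀ ha]; simp
  · rw [comp_algebraMap, aeval_algebraMap_eq_comp, ← RatFunc.algebraMap_X]
    congr 1
    simp only [sub_comp, mul_comp, C_comp, Polynomial.X_comp, add_sub_cancel_right]
    rw [← mul_assoc, ← C_mul, inv_mul_cancel₀ ha]; simp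

/-- The Möbius transformation `1 / (x - t)`, sending `t` to infinity. -/
theorem inverses_inv_X_sub_C (t : K) :
    Inverses ((RatFunc.X - RatFunc.C t)⁻¹) (RatFunc.X⁻¹ + RatFunc.C t) := by
  have hX : IsNonconst (RatFunc.X : RatFunc K) := isNonconst_X
  have h1 : IsNonconst ((RatFunc.X - RatFunc.C t)⁻¹) := fun c e =>
    hX (c⁻¹ + t) (by rw [map_add, map_inv₀, ← e, inv_inv]; ring)
  have h2 : IsNonconst (RatFunc.X⁻¹ + RatFunc.C t) := fun c e =>
    hX (c - t)⁻¹ (by rw [map_inv₀, map_sub, ← e]; simp)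
  refine ⟨h1, h2, ?_, ?_⟩
  · rw [← compHom_apply h2, map_inv₀, map_sub, compHom_apply, compHom_apply, comp_C, X_comp]
    simp
  · rw [← compHom_apply h1, map_add, map_inv₀, compHom_apply, compHom_apply, comp_C, X_comp]
    simp

/-- A rational function that satisfies `p(v) = q` for polynomials `p` (nonconstant) and `q` is a
polynomial. -/
theorem exists_eq_algebraMap_of_aeval_eq {p q : K[X]} (hp : p.natDegree ≠ 0) {v : RatFunc K}
    (e : aeval v p = algebraMap K[X] (RatFunc K) q) : ∃ c, v = algebraMap K[X] (RatFunc K) c := by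
  have hp0 : p.leadingCoeff ≠ 0 := leadingCoeff_ne_zero.mpr (by rintro rfl; simp at hp)
  -- `v` is a root of `p - q` over `K[X]`, monic after scaling because `q` only changes the constant
  -- term. So `v` is integral over the integrally closed ring `K[X]`.
  set r : K[X][X] := C (C p.leadingCoeff⁻¹) * (p.map C - C q) with hr
  have hd : (p.map (C : K →+* K[X])).degree = p.degree := degree_map_eq_of_injective C_injective _
  have hlt : (C q : K[X][X]).degree < (p.map (C : K →+* K[X])).degree := by
    rw [hd]
    exact degree_C_le.trans_lt (natDegree_pos_iff_degree_pos.mp (Nat.pos_of_ne_zero hp))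
  have hmon : r.Monic := by
    rw [Monic, hr, leadingCoeff_mul, leadingCoeff_sub_of_degree_lt hlt,
      leadingCoeff_map_of_injective C_injective,
      leadingCoeff_C, ← C_mul, inv_mul_cancel₀ hp0, C_1]
  have hint : IsIntegral K[X] v := by
    refine ⟨r, hmon, ?_⟩
    rw [hr, eval₂_mul, eval₂_sub, eval₂_C, eval₂_C, eval₂_map]
    rw [RatFunc.algebraMap_comp_C, ← e, aeval_def, RatFunc.algebraMap_eq_C, sub_self, mul_zero]
  obtain ⟨c, hc⟩ := IsIntegrallyClosed.isIntegral_iff.mp hint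
  exact ⟨c, hc.symm⟩

theorem natDegree_eq_one_of_isCompUnit {p : K[X]}
    (h : IsCompUnit (algebraMap K[X] (RatFunc K) p)) : p.natDegree = 1 := by
  obtain ⟨h0, v, -, e, -⟩ := h
  rw [comp_algebraMap, ← RatFunc.algebraMap_X] at e
  obtain ⟨c, rfl⟩ := exists_eq_algebraMap_of_aeval_eq (natDegree_ne_zero_of_isNonconst h0) e
  rw [aeval_algebraMap_eq_comp] at e
  have := congrArg natDegree (RatFunc.algebraMap_injective K e)
  rw [natDegree_comp, natDegree_X] at this
  exact Nat.eq_one_of_mul_eq_one_right this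

/-- If `g ∘ k` is a polynomial for a nonconstant polynomial `k`, then so is `g`. -/
theorem exists_eq_algebraMap_of_comp_eq {g : RatFunc K} {k P : K[X]} (hk : k.natDegree ≠ 0)
    (e : comp g (algebraMap K[X] (RatFunc K) k) = algebraMap K[X] (RatFunc K) P) :
    ∃ G, g = algebraMap K[X] (RatFunc K) G := by
  have hd : g.denom.comp k ≠ 0 := fun h => by
    rcases comp_eq_zero_iff.mp h with h | ⟨-, h⟩
    · exact g.denom_ne_zero h
    · exact hk (by rw [h]; simp)
  rw [comp_eq_div, aeval_algebraMap_eq_comp, aeval_algebraMap_eq_comp,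
    div_eq_iff (RatFunc.algebraMap_ne_zero hd), ← map_mul] at e
  have e := RatFunc.algebraMap_injective K e
  have hc : IsCoprime (g.num.comp k) (g.denom.comp k) :=
    g.isCoprime_num_denom.map (Polynomial.compRingHom k)
  -- Numerator and denominator stay coprime after substituting `k`, yet the denominator divides the
  -- numerator.
  have hu : IsUnit (g.denom.comp k) := hc.symm.isUnit_of_dvd' dvd_rfl ⟨P, by rw [e, mul_comm]⟩
  have h0 := natDegree_eq_zero_of_isUnit hu
  rw [natDegree_comp, mul_eq_zero, or_iff_left hk] at h0
  have h1 : g.denom = 1 := by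
    rw [g.monic_denom.natDegree_eq_zero] at h0; exact h0
  refine ⟨g.num, ?_⟩
  conv_lhs => rw [← RatFunc.num_div_denom g, h1, map_one, div_one]

end Composition

/-! ### Reduction to polynomial decompositions; complete decompositions -/

section Normalization

variable {K : Type*} [Field K]

theorem intDegree_add_C {x : RatFunc K} (hx : 0 < x.intDegree) (a : K) :
    (x + RatFunc.C a).intDegree = x.intDegree := by
  rcases eq_or_ne a 0 with rfl | ha
  · simp
  have h0 : ∀ (b : K) (y : RatFunc K), 0 < y.intDegree → y + RatFunc.C b ≠ 0 := by
    intro b y hy e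
    rw [eq_neg_of_add_eq_zero_left e, RatFunc.intDegree_neg, RatFunc.intDegree_C] at hy
    exact lt_irrefl _ hy
  have hC : RatFunc.C a ≠ 0 := (_root_.map_ne_zero _).mpr ha
  have h1 := RatFunc.intDegree_add_le hC (h0 a x hx)
  rw [RatFunc.intDegree_C, max_eq_left hx.le] at h1
  refine le_antisymm h1 ?_
  have hx' : x + RatFunc.C a + -RatFunc.C a = x := by ring
  have h2 := RatFunc.intDegree_add_le (x := x + RatFunc.C a) (neg_ne_zero.mpr hC)
    (by rw [hx']; rintro rfl; simp at hx)
  rw [hx', RatFunc.intDegree_neg, RatFunc.intDegree_C] at h2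
  rcases le_max_iff.mp h2 with h | h
  · exact h
  · omega

/-- When `h` has a pole at infinity the leading term cannot cancel; the induction is Horner's
scheme. -/
theorem intDegree_aeval {h : RatFunc K} (hh : 0 < h.intDegree) (p : K[X]) :
    (aeval h p).intDegree = p.natDegree * h.intDegree := by
  have hh0 : h ≠ 0 := by rintro rfl; simp at hh
  have hhc : IsNonconst h := by rintro c rfl; simp at hh
  induction hn : p.natDegree using Nat.strong_induction_on generalizing p with
  | _ n ih =>
    rcases Nat.eq_zero_or_pos n with rfl | hpos
    · obtain ⟨c, rfl⟩ := natDegree_eq_zero.mp hn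
      simp
    have hdeg : p.divX.natDegree = n - 1 := by rw [natDegree_divX_eq_natDegree_tsub_one, hn]
    have hq : p.divX ≠ 0 := by
      intro h0
      rw [divX_eq_zero_iff] at h0
      rw [h0, natDegree_C] at hn
      omega
    have e : aeval h p = aeval h p.divX * h + RatFunc.C (p.coeff 0) := by
      conv_lhs => rw [← divX_mul_X_add p]
      simp
    have hq' : aeval h p.divX ≠ 0 := hhc.eval₂_ne_zero hq
    have e2 : (aeval h p.divX * h).intDegree = n * h.intDegree := by
      rw [RatFunc.intDegree_mul hq' hh0, ih (n - 1) (by omega) _ hdeg]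
      push_cast [Nat.cast_sub hpos]
      ring
    rw [e, intDegree_add_C, e2]
    rw [e2]; positivity

/-- Some unit moves the value of `h` at infinity to infinity. -/
theorem exists_inverses_intDegree_pos {h : RatFunc K} (hh : IsNonconst h) :
    ∃ u v, Inverses u v ∧ 0 < (comp u h).intDegree := by
  by_cases hpos : 0 < h.intDegree
  · exact ⟨_, _, Inverses.refl, by rwa [X_comp]⟩
  set n := h.denom.natDegree with hn
  -- The value of `h` at infinity: the denominator is monic of degree `n`, and the coefficient is
  -- `0` when the numerator has smaller degree.
  set t := h.num.coeff n with ht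
  refine ⟨_, _, inverses_inv_X_sub_C t, ?_⟩
  rw [← compHom_apply hh, map_inv₀, map_sub, compHom_apply, compHom_apply, comp_C, X_comp,
    RatFunc.intDegree_inv]
  have hd : algebraMap K[X] (RatFunc K) h.denom ≠ 0 :=
    RatFunc.algebraMap_ne_zero h.denom_ne_zero
  have hlead : h.denom.coeff n = 1 := h.monic_denom
  have hnum : h.num.natDegree ≤ n := by
    rw [RatFunc.intDegree] at hpos; omega
  have e : h - RatFunc.C t = algebraMap K[X] (RatFunc K) (h.num - C t * h.denom) /
      algebraMap K[X] (RatFunc K) h.denom := by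
    rw [eq_div_iff hd, sub_mul, map_sub, map_mul, RatFunc.algebraMap_C]
    nth_rw 1 [← RatFunc.num_div_denom h]
    rw [div_mul_cancel₀ _ hd]
  have hr : h.num - C t * h.denom ≠ 0 := by
    intro h0
    rw [h0, map_zero, zero_div] at e
    exact hh t (sub_eq_zero.mp e)
  have hle : (h.num - C t * h.denom).natDegree ≤ n :=
    (natDegree_sub_le _ _).trans (max_le hnum (natDegree_C_mul_le _ _))
  have hlt : (h.num - C t * h.denom).natDegree < n := by
    refine lt_of_le_of_ne hle fun h1 => hr ?_
    rw [← leadingCoeff_eq_zero, leadingCoeff, h1, coeff_sub, coeff_C_mul, hlead, mul_one, ← ht,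
      sub_self]
  rw [e, RatFunc.intDegree_div (RatFunc.algebraMap_ne_zero hr) hd, RatFunc.intDegree_polynomial,
    RatFunc.intDegree_polynomial]
  omega

/-- Up to inserting a unit and its inverse, a decomposition of a polynomial into rational functions
is a decomposition into polynomials. -/
theorem exists_polynomial_decomposition {g h : RatFunc K} {P : K[X]} (hg : IsNonconst g)
    (hh : IsNonconst h) (hP : comp g h = algebraMap K[X] (RatFunc K) P) :
    ∃ u v G H, Inverses u v ∧ comp u h = algebraMap K[X] (RatFunc K) H ∧
      comp g v = algebraMap K[X] (RatFunc K) G ∧ G.comp H = P ∧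
      G.natDegree ≠ 0 ∧ H.natDegree ≠ 0 := by
  obtain ⟨u, v, huv, hpos⟩ := exists_inverses_intDegree_pos hh
  have hg' := hg.comp huv.2.1
  have hh' := huv.1.comp hh
  have hP' : comp (comp g v) (comp u h) = algebraMap K[X] (RatFunc K) P := by
    rw [comp_assoc g _ hh', huv.symm.comp_cancel hh, hP]
  have hP0 : IsNonconst (algebraMap K[X] (RatFunc K) P) := hP ▸ hg.comp hh
  generalize hh'_def : comp u h = h' at *
  generalize hg'_def : comp g v = g' at *
  have hd0 : aeval h' g'.denom ≠ 0 := hh'.eval₂_ne_zero g'.denom_ne_zero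
  have hn0 : aeval h' g'.num ≠ 0 := hh'.eval₂_ne_zero
    (RatFunc.num_ne_zero (by rintro rfl; exact hg' 0 (by simp)))
  -- Degrees at infinity multiply: `(deg num - deg denom) * intDegree h' = deg P > 0`.
  have hdeg : g'.denom.natDegree < g'.num.natDegree := by
    have h1 := congrArg RatFunc.intDegree hP'
    rw [comp_eq_div, RatFunc.intDegree_div hn0 hd0, intDegree_aeval hpos, intDegree_aeval hpos,
      RatFunc.intDegree_polynomial, ← sub_mul] at h1
    have h2 : 0 < (P.natDegree : ℤ) := by
      exact_mod_cast Nat.pos_of_ne_zero (natDegree_ne_zero_of_isNonconst hP0)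
    rw [← h1] at h2
    have h3 := pos_of_mul_pos_left h2 hpos.le
    omega
  obtain ⟨H, rfl⟩ : ∃ H, h' = algebraMap K[X] (RatFunc K) H := by
    have hn : g'.num.leadingCoeff ≠ 0 := leadingCoeff_ne_zero.mpr (by
      intro h0; rw [h0] at hdeg; simp at hdeg)
    -- `h'` is a root of `num - P * denom`, whose leading term comes from `num` alone by `hdeg`;
    -- hence `h'` is integral over `K[X]`.
    set r : K[X][X] := C (C g'.num.leadingCoeff⁻¹) * (g'.num.map C - C P * g'.denom.map C) with hr
    have hlt : (C P * g'.denom.map (C : K →+* K[X])).degree <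
        (g'.num.map (C : K →+* K[X])).degree := by
      refine degree_lt_degree ?_
      rw [natDegree_map_eq_of_injective C_injective]
      refine (natDegree_C_mul_le _ _).trans_lt ?_
      rwa [natDegree_map_eq_of_injective C_injective]
    have hmon : r.Monic := by
      rw [Monic, hr, leadingCoeff_mul, leadingCoeff_sub_of_degree_lt hlt,
        leadingCoeff_map_of_injective C_injective, leadingCoeff_C, ← C_mul, inv_mul_cancel₀ hn, C_1]
    have hint : IsIntegral K[X] h' := by
      refine ⟨r, hmon, ?_⟩
      rw [comp_eq_div, div_eq_iff hd0] at hP'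
      rw [hr, eval₂_mul, eval₂_sub, eval₂_mul, eval₂_C, eval₂_C, eval₂_map, eval₂_map,
        RatFunc.algebraMap_comp_C]
      rw [aeval_def, aeval_def, RatFunc.algebraMap_eq_C] at hP'
      rw [hP', sub_self, mul_zero]
    obtain ⟨c, hc⟩ := IsIntegrallyClosed.isIntegral_iff.mp hint
    exact ⟨c, hc.symm⟩
  have hH := natDegree_ne_zero_of_isNonconst hh'
  obtain ⟨G, rfl⟩ := exists_eq_algebraMap_of_comp_eq hH hP'
  rw [comp_algebraMap, aeval_algebraMap_eq_comp] at hP'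
  exact ⟨u, v, G, H, huv, hh'_def, hg'_def, RatFunc.algebraMap_injective K hP',
    natDegree_ne_zero_of_isNonconst hg', hH⟩

theorem natDegree_eq_one_or_of_isIndecomposable {p q : K[X]}
    (h : IsIndecomposable (algebraMap K[X] (RatFunc K) (p.comp q))) (hp : p.natDegree ≠ 0)
    (hq : q.natDegree ≠ 0) : p.natDegree = 1 ∨ q.natDegree = 1 := by
  refine (h.2.2 _ _ (isNonconst_algebraMap hp) (isNonconst_algebraMap hq) ?_).imp
    natDegree_eq_one_of_isCompUnit natDegree_eq_one_of_isCompUnit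
  rw [comp_algebraMap, aeval_algebraMap_eq_comp]

theorem IsIndecomposable.natDegree_ne_one {p : K[X]}
    (h : IsIndecomposable (algebraMap K[X] (RatFunc K) p)) : p.natDegree ≠ 1 := fun h1 =>
  h.2.1 (isCompUnit_algebraMap h1)

/-- A polynomial of degree at least two is indecomposable as a rational function as soon as it is
indecomposable as a polynomial. -/
theorem isIndecomposable_of_polynomial {P : K[X]} (hP : 2 ≤ P.natDegree)
    (h : ∀ G H : K[X], G.comp H = P → G.natDegree = 1 ∨ H.natDegree = 1) :
    IsIndecomposable (algebraMap K[X] (RatFunc K) P) := by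
  refine ⟨isNonconst_algebraMap (by omega), fun hu => ?_, fun g k hg hk e => ?_⟩
  · have := natDegree_eq_one_of_isCompUnit hu
    omega
  · obtain ⟨u, v, G, H, huv, h1, h2, h3, -, -⟩ := exists_polynomial_decomposition hg hk e.symm
    rcases h G H h3 with hd | hd
    · left
      rw [← huv.symm.cancel_comp g, h2]
      exact (isCompUnit_algebraMap hd).comp huv.isCompUnit
    · right
      rw [← huv.symm.comp_cancel hk, h1]
      exact huv.symm.isCompUnit.comp (isCompUnit_algebraMap hd)

theorem compList_append {l₁ l₂ : List (RatFunc K)} (h₁ : ∀ g ∈ l₁, IsNonconst g)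
    (h₂ : ∀ g ∈ l₂, IsNonconst g) :
    compList (l₁ ++ l₂) = comp (compList l₁) (compList l₂) ∧ IsNonconst (compList l₁) := by
  have key : ∀ l : List (RatFunc K), (∀ g ∈ l, IsNonconst g) → IsNonconst (compList l) := by
    intro l hl
    induction l with
    | nil => exact isNonconst_X
    | cons a l ih =>
      exact (hl a (by simp)).comp (ih fun g hg => hl g (by simp [hg]))
  refine ⟨?_, key _ h₁⟩
  induction l₁ with
  | nil => exact (X_comp _).symm
  | cons a l ih =>
    have hl : ∀ g ∈ l, IsNonconst g := fun g hg => h₁ g (by simp [hg])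
    change comp a (compList (l ++ l₂)) = comp (comp a (compList l)) (compList l₂)
    rw [ih hl, comp_assoc _ _ (key _ h₂)]

theorem isNonconst_compList {l : List (RatFunc K)} (h : ∀ g ∈ l, IsNonconst g) :
    IsNonconst (compList l) :=
  (compList_append h (l₂ := []) (by simp)).2

theorem IsCompleteDecomposition.append {f g : RatFunc K} {l₁ l₂ : List (RatFunc K)}
    (h₁ : IsCompleteDecomposition f l₁) (h₂ : IsCompleteDecomposition g l₂) :
    IsCompleteDecomposition (comp f g) (l₁ ++ l₂) := by
  refine ⟨fun a ha => ?_, ?_⟩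
  · rcases List.mem_append.mp ha with ha | ha
    exacts [h₁.1 a ha, h₂.1 a ha]
  · rw [(compList_append (fun a ha => (h₁.1 a ha).1) fun a ha => (h₂.1 a ha).1).1, ← h₁.2, ← h₂.2]

theorem IsIndecomposable.isCompleteDecomposition {f : RatFunc K} (h : IsIndecomposable f) :
    IsCompleteDecomposition f [f] :=
  ⟨by simpa using h, (comp_X f).symm⟩

/-- Splitting into polynomials of smaller degree terminates, and polynomial indecomposability
suffices. Nonemptiness is kept for the final length comparison. -/
theorem exists_isCompleteDecomposition {P : K[X]} (hP : 2 ≤ P.natDegree) :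
    ∃ l, IsCompleteDecomposition (algebraMap K[X] (RatFunc K) P) l ∧ l ≠ [] := by
  induction hn : P.natDegree using Nat.strong_induction_on generalizing P with
  | _ n ih =>
    by_cases h : ∀ G H : K[X], G.comp H = P → G.natDegree = 1 ∨ H.natDegree = 1
    · exact ⟨_, (isIndecomposable_of_polynomial hP h).isCompleteDecomposition, by simp⟩
    · push Not at h
      obtain ⟨G, H, e, hG, hH⟩ := h
      have hd : G.natDegree * H.natDegree = n := by rw [← natDegree_comp, e, hn]
      have hG0 : G.natDegree ≠ 0 := by intro h0; rw [h0] at hd; omega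
      have hH0 : H.natDegree ≠ 0 := by intro h0; rw [h0] at hd; omega
      obtain ⟨l₁, h₁, hl⟩ := ih G.natDegree
        (by rw [← hd]; exact lt_mul_of_one_lt_right (by omega) (by omega))
        (by omega) rfl
      obtain ⟨l₂, h₂, -⟩ := ih H.natDegree
        (by rw [← hd]; exact lt_mul_of_one_lt_left (by omega) (by omega))
        (by omega) rfl
      refine ⟨l₁ ++ l₂, ?_, by simp [hl]⟩
      rw [← e, ← aeval_algebraMap_eq_comp, ← comp_algebraMap]
      exact h₁.append h₂

end Normalization

/-! ### Ramification and the right components of `P_q` -/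

section RightComponents

/-- Multiplicativity of ramification indices: split off from `G` its full power of `x - H(a)`; the
cofactor does not vanish at `H(a)`. -/
theorem rootMultiplicity_comp {K : Type*} [Field K] {G H : K[X]} (hG : G ≠ 0)
    (hH : H.natDegree ≠ 0) (a : K) :
    (G.comp H).rootMultiplicity a =
      G.rootMultiplicity (H.eval a) * (H - C (H.eval a)).rootMultiplicity a := by
  classical
  have hcomp : ∀ {A : K[X]}, A ≠ 0 → A.comp H ≠ 0 := fun {A} hA h => by
    rcases comp_eq_zero_iff.mp h with h | ⟨-, h⟩
    · exact hA h
    · exact hH (by rw [h]; simp)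
  obtain ⟨G₁, e, hnd⟩ := exists_eq_pow_rootMultiplicity_mul_and_not_dvd G hG (H.eval a)
  have h0 := hcomp hG
  have e' : G.comp H = (H - C (H.eval a)) ^ G.rootMultiplicity (H.eval a) * G₁.comp H := by
    conv_lhs => rw [e]
    simp
  have h1 : (G₁.comp H).rootMultiplicity a = 0 := rootMultiplicity_eq_zero (by
    rw [IsRoot.def, eval_comp]
    exact fun h => hnd (dvd_iff_isRoot.mpr h))
  rw [e'] at h0 ⊢
  rw [rootMultiplicity_mul h0, h1, add_zero, ← count_roots, roots_pow, Multiset.count_nsmul,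
    count_roots]

variable {F : Type*} [Field F] [Fintype F]

theorem sum_rootMultiplicity_of_splits {p : F[X]} (hp : p.Splits) :
    ∑ a, p.rootMultiplicity a = p.natDegree := by
  classical
  rw [hp.natDegree_eq_card_roots, ← Multiset.sum_count_eq_card (s := Finset.univ) (by simp)]
  simp

theorem eq_C_mul_prod_of_splits {p : F[X]} (hp : p.Splits) :
    p = C p.leadingCoeff * ∏ a, (X - C a) ^ p.rootMultiplicity a := by
  classical
  conv_lhs => rw [hp.eq_prod_roots, Finset.prod_multiset_map_count]
  congr 1
  rw [Finset.prod_subset (Finset.subset_univ _)]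
  · simp
  · intro a _ ha
    rw [Multiset.count_eq_zero.mpr (by simpa using ha), pow_zero]

theorem splits_X_pow_card_sub_X : (X ^ Fintype.card F - X : F[X]).Splits := by
  rw [splits_iff_card_roots, FiniteField.roots_X_pow_card_sub_X,
    FiniteField.X_pow_card_sub_X_natDegree_eq F Fintype.one_lt_card]
  rfl

theorem X_pow_card_sub_X_ne_zero : (X ^ Fintype.card F - X : F[X]) ≠ 0 :=
  FiniteField.X_pow_card_sub_X_ne_zero F Fintype.one_lt_card

theorem natDegree_X_pow_card_sub_X : (X ^ Fintype.card F - X : F[X]).natDegree = Fintype.card F :=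
  FiniteField.X_pow_card_sub_X_natDegree_eq F Fintype.one_lt_card

theorem X_pow_card_sub_X_eq_prod : (X ^ Fintype.card F - X : F[X]) = ∏ a : F, (X - C a) := by
  classical
  have hm : (X ^ Fintype.card F - X : F[X]).Monic :=
    monic_X_pow_sub (by rw [degree_X]; exact_mod_cast Fintype.one_lt_card)
  conv_lhs => rw [splits_X_pow_card_sub_X.eq_prod_roots_of_monic hm,
    FiniteField.roots_X_pow_card_sub_X]
  rfl

variable (F) in
theorem rootMultiplicity_X_pow_card_sub_X_pow (n : ℕ) (a : F) :
    ((X ^ Fintype.card F - X : F[X]) ^ n).rootMultiplicity a = n := by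
  classical
  rw [← count_roots, roots_pow, FiniteField.roots_X_pow_card_sub_X, Multiset.count_nsmul,
    Multiset.count_eq_one_of_mem Finset.univ.nodup (by simp), mul_one]

/-- In characteristic `p` both `q - 1` and the derivative of `x^q - x` equal `-1`. -/
theorem derivative_X_pow_card_sub_X_pow :
    derivative ((X ^ Fintype.card F - X : F[X]) ^ (Fintype.card F - 1)) =
      (X ^ Fintype.card F - X) ^ (Fintype.card F - 2) := by
  have h1 : ((Fintype.card F - 1 : ℕ) : F[X]) = -1 := by
    rw [Nat.cast_sub Fintype.card_pos, ← map_natCast (C : F →+* F[X]), Nat.cast_card_eq_zero]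
    simp
  have h2 : ((Fintype.card F : ℕ) : F[X]) = 0 := by
    rw [← map_natCast (C : F →+* F[X]), Nat.cast_card_eq_zero, map_zero]
  rw [derivative_pow, derivative_sub, derivative_X_pow, derivative_X]
  simp only [map_natCast, h1, h2]
  rw [Nat.sub_sub]
  ring

theorem natCast_eq_zero_iff_card_dvd (hq : (Fintype.card F).Prime) (n : ℕ) :
    (n : F) = 0 ↔ Fintype.card F ∣ n := by
  have := ringChar.spec F n
  rw [this]
  have h1 : ringChar F ∣ Fintype.card F := (ringChar.spec F _).mp (Nat.cast_card_eq_zero F)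
  rcases (Nat.dvd_prime hq).mp h1 with h | h
  · exact absurd h (CharP.ringChar_ne_one)
  · rw [h]

/-- A polynomial right component of `(x^q - x)^(q-1)`, for `q` prime, is a power of a linear
polynomial or of `x^q - x`, up to a linear polynomial on the left. -/
theorem right_component_classification (hq : (Fintype.card F).Prime) {G H : F[X]}
    (hH : H.natDegree ≠ 0)
    (e : G.comp H = (X ^ Fintype.card F - X) ^ (Fintype.card F - 1)) :
    ∃ (U : F[X]) (d : ℕ), U.natDegree = 1 ∧ d ∣ Fintype.card F - 1 ∧
      ((∃ b, H = U.comp ((X - C b) ^ d)) ∨ H = U.comp ((X ^ Fintype.card F - X) ^ d)) := by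
  classical
  have hq2 := hq.two_le
  set q := Fintype.card F with hqdef
  set m : F → ℕ := fun a => (H - C (H.eval a)).rootMultiplicity a with hm
  have hsub : ∀ t, (H - C t).natDegree = H.natDegree := fun t => natDegree_sub_C
  have hsub0 : ∀ t, H - C t ≠ 0 := fun t h => hH (by rw [← hsub t, h, natDegree_zero])
  have hlc : ∀ t, (H - C t).leadingCoeff ≠ 0 := fun t => leadingCoeff_ne_zero.mpr (hsub0 t)
  have hP0 : (X ^ q - X : F[X]) ^ (q - 1) ≠ 0 := pow_ne_zero _ X_pow_card_sub_X_ne_zero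
  have hG : G ≠ 0 := by rintro rfl; rw [zero_comp] at e; exact hP0 e.symm
  have hmul : ∀ a, G.rootMultiplicity (H.eval a) * m a = q - 1 := fun a => by
    rw [hm, ← rootMultiplicity_comp hG hH, e, rootMultiplicity_X_pow_card_sub_X_pow]
  have hmpos : ∀ a, 0 < m a := fun a => Nat.pos_of_ne_zero fun h => by
    have := hmul a; rw [h] at this; omega
  have hmdvd : ∀ a, m a ∣ q - 1 := fun a => ⟨_, by rw [mul_comm, hmul]⟩
  have hmconst : ∀ a b, H.eval a = H.eval b → m a = m b := fun a b h => by
    have h1 := hmul a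
    rw [h, ← hmul b] at h1
    have : 0 < G.rootMultiplicity (H.eval b) := Nat.pos_of_ne_zero fun h => by
      have := hmul b; rw [h] at this; omega
    exact Nat.eq_of_mul_eq_mul_left this h1
  -- `H(b)` is a root of `G`, so `H - H(b)` divides `P_q`, which splits over `F`.
  have hsplit : ∀ b, (H - C (H.eval b)).Splits := fun b => by
    refine Splits.of_dvd (splits_X_pow_card_sub_X.pow (q - 1)) hP0 ?_
    rw [← e]
    have hroot : G.IsRoot (H.eval b) := by
      rw [IsRoot.def, ← eval_comp, e]
      simp [hqdef, FiniteField.pow_card, show Fintype.card F - 1 ≠ 0 by omega]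
    obtain ⟨G₁, h1⟩ := dvd_iff_isRoot.mpr hroot
    exact ⟨G₁.comp H, by rw [h1]; simp⟩
  have hmult : ∀ a b, (H - C (H.eval b)).rootMultiplicity a =
      if H.eval a = H.eval b then m a else 0 := fun a b => by
    split_ifs with h
    · rw [← h]
    · refine rootMultiplicity_eq_zero fun h1 => h ?_
      rw [IsRoot.def, eval_sub, eval_C, sub_eq_zero] at h1
      exact h1
  have hfiber : ∀ b, (Finset.univ.filter fun a => H.eval a = H.eval b).card * m b =
      H.natDegree := fun b => by
    rw [← hsub (H.eval b), ← sum_rootMultiplicity_of_splits (hsplit b)]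
    simp_rw [hmult]
    rw [← Finset.sum_filter, Finset.sum_const_nat]
    intro a ha
    exact hmconst a b (by simpa using ha)
  have hform : ∀ b (R : F[X]), ∏ a, (X - C a) ^ (if H.eval a = H.eval b then m a else 0) = R →
      H = (C (H - C (H.eval b)).leadingCoeff * X + C (H.eval b)).comp R := fun b R hR => by
    have := eq_C_mul_prod_of_splits (hsplit b)
    simp_rw [hmult] at this
    rw [hR] at this
    simp only [add_comp, mul_comp, C_comp, Polynomial.X_comp]
    rw [← this]; ring
  by_cases hdvd : q ∣ H.natDegree
  -- Fibre size times ramification index is `deg H`, and the index divides `q - 1`; so `q` divides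
  -- the fibre size and the fibre of `0` is all of `F`.
  · have hcop : q.Coprime (m 0) := by
      refine (Nat.Prime.coprime_iff_not_dvd hq).mpr fun h => ?_
      have := Nat.le_of_dvd (by omega) (h.trans (hmdvd 0))
      omega
    have hcard : (Finset.univ.filter fun a => H.eval a = H.eval 0) = Finset.univ := by
      rw [← hfiber 0] at hdvd
      have h1 := hcop.dvd_of_dvd_mul_right hdvd
      refine Finset.eq_univ_of_card _ (le_antisymm (Finset.card_le_univ _) ?_)
      exact Nat.le_of_dvd (Finset.card_pos.mpr ⟨0, by simp⟩) h1
    have hall : ∀ a, H.eval a = H.eval 0 := fun a => by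
      have := Finset.mem_univ a
      rw [← hcard] at this
      simpa using this
    refine ⟨_, m 0, natDegree_linear (hlc _), hmdvd 0, Or.inr (hform 0 _ ?_)⟩
    rw [X_pow_card_sub_X_eq_prod, ← Finset.prod_pow]
    refine Finset.prod_congr rfl fun a _ => ?_
    rw [if_pos (hall a), hmconst a 0 (hall a)]
  -- Riemann–Hurwitz with tame ramification: `deg H' = deg H - 1` since `q ∤ deg H`, and `H'` splits
  -- over `F` because by the chain rule it divides `P_q'`.
  · have hsum : ∑ a, (m a - 1) = H.natDegree - 1 := by
      have hnd : (derivative H).natDegree = H.natDegree - 1 := by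
        refine natDegree_eq_of_le_of_coeff_ne_zero (natDegree_derivative_le H) ?_
        rw [coeff_derivative, Nat.sub_add_cancel (Nat.pos_of_ne_zero hH), coeff_natDegree]
        refine mul_ne_zero (leadingCoeff_ne_zero.mpr (by rintro rfl; simp at hH)) ?_
        have := (natCast_eq_zero_iff_card_dvd hq H.natDegree).not.mpr hdvd
        rwa [← Nat.sub_add_cancel (Nat.pos_of_ne_zero hH), Nat.cast_add, Nat.cast_one] at this
      have hs : (derivative H).Splits := by
        refine Splits.of_dvd (splits_X_pow_card_sub_X.pow (q - 2))
          (pow_ne_zero _ X_pow_card_sub_X_ne_zero) ?_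
        rw [← derivative_X_pow_card_sub_X_pow, ← hqdef, ← e, derivative_comp]
        exact dvd_mul_right _ _
      rw [← hnd, ← sum_rootMultiplicity_of_splits hs]
      refine Finset.sum_congr rfl fun a _ => ?_
      have h1 := derivative_rootMultiplicity_of_root_of_mem_nonZeroDivisors
        (p := H - C (H.eval a)) (t := a) (by simp) (mem_nonZeroDivisors_of_ne_zero (by
          rw [Ne, natCast_eq_zero_iff_card_dvd hq]
          intro h
          have := Nat.le_of_dvd (by omega) (h.trans (hmdvd a))
          omega))
      rw [derivative_sub, derivative_C, sub_zero] at h1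
      exact h1.symm
    rcases Nat.lt_or_ge 1 H.natDegree with hn | hn
    · obtain ⟨b, -, hb⟩ : ∃ b ∈ Finset.univ, m b - 1 ≠ 0 :=
        Finset.exists_ne_zero_of_sum_ne_zero (by rw [hsum]; omega)
      have hpart : ∀ c, ∑ a with H.eval a = H.eval c, (m a - 1) +
          (Finset.univ.filter fun a => H.eval a = H.eval c).card = H.natDegree := fun c => by
        rw [← hfiber c, Finset.sum_const_nat (m := m c - 1), ← Nat.mul_succ,
          Nat.succ_eq_add_one, Nat.sub_add_cancel (hmpos c)]
        intro a ha
        rw [hmconst a c (by simpa using ha)]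
      have hhalf : ∀ c, m c - 1 ≠ 0 →
          2 * (Finset.univ.filter fun a => H.eval a = H.eval c).card ≤ H.natDegree := fun c hc => by
        rw [← hfiber c, mul_comm]
        exact Nat.mul_le_mul_left _ (by omega)
      -- A ramified fibre contributes at least half of `deg H`; two of them would exceed the total
      -- `deg H - 1`.
      have hrest : ∀ c, H.eval c ≠ H.eval b → m c - 1 = 0 := fun c hc => by
        by_contra hne
        have hdisj : Disjoint (Finset.univ.filter fun a => H.eval a = H.eval b)
            (Finset.univ.filter fun a => H.eval a = H.eval c) := by
          rw [Finset.disjoint_left]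
          intro a ha hac
          simp only [Finset.mem_filter, Finset.mem_univ, true_and] at ha hac
          exact hc (hac.symm.trans ha)
        have hle : ∑ a with H.eval a = H.eval b, (m a - 1) +
            ∑ a with H.eval a = H.eval c, (m a - 1) ≤ ∑ a, (m a - 1) := by
          rw [← Finset.sum_union hdisj]
          exact Finset.sum_le_sum_of_subset (Finset.subset_univ _)
        have := hpart b
        have := hpart c
        have := hhalf b hb
        have := hhalf c hne
        omega
      -- The only ramified fibre contributes `deg H` minus its size, which must be `deg H - 1`.
      have hone : (Finset.univ.filter fun a => H.eval a = H.eval b).card = 1 := by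
        have h1 := hpart b
        have h2 : ∑ a with H.eval a = H.eval b, (m a - 1) = ∑ a, (m a - 1) := by
          refine Finset.sum_subset (Finset.subset_univ _) fun a _ ha => hrest a ?_
          simpa using ha
        omega
      have huniq : ∀ a, H.eval a = H.eval b → a = b := fun a ha =>
        Finset.card_le_one.mp hone.le a (by simpa using ha) b (by simp)
      refine ⟨_, m b, natDegree_linear (hlc _), hmdvd b, Or.inl ⟨b, hform b _ ?_⟩⟩
      rw [Finset.prod_eq_single b]
      · simp
      · intro a _ hab
        rw [if_neg fun h => hab (huniq a h), pow_zero]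
      · simp
    · exact ⟨H, 1, by omega, one_dvd _, Or.inl ⟨0, by simp⟩⟩

end RightComponents

/-! ### Indecomposable steps between right components, and the length for `q` prime -/

section PrimeCard

theorem eq_of_comp_eq {K : Type*} [Field K] {G R k : K[X]} (hk : k.natDegree ≠ 0)
    (e : G.comp k = R.comp k) : G = R := by
  refine RatFunc.algebraMap_injective K (comp_left_injective (isNonconst_algebraMap hk) ?_)
  rw [comp_algebraMap, comp_algebraMap, aeval_algebraMap_eq_comp, aeval_algebraMap_eq_comp, e]

theorem prime_of_isIndecomposable_pow {K : Type*} [Field K] {t : K} {n : ℕ}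
    (h : IsIndecomposable (algebraMap K[X] (RatFunc K) ((X - C t) ^ n))) : n.Prime := by
  have h0 := natDegree_ne_zero_of_isNonconst h.1
  have h1 := h.natDegree_ne_one
  rw [natDegree_pow, natDegree_X_sub_C, mul_one] at h0 h1
  by_contra hn
  obtain ⟨r, s, hr, hs, rfl⟩ := (Nat.not_prime_iff_exists_mul_eq (by omega)).mp hn
  have e : (X - C t) ^ (r * s) = (X ^ r : K[X]).comp ((X - C t) ^ s) := by
    rw [X_pow_comp, ← pow_mul, mul_comm]
  rw [e] at h
  have hr0 : r ≠ 0 := fun h => by simp [h] at h0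
  have hs0 : s ≠ 0 := fun h => by simp [h] at h0
  rcases natDegree_eq_one_or_of_isIndecomposable h (by simpa) (by simpa) with h2 | h2
  · rw [natDegree_X_pow] at h2; subst h2; simp at hs
  · rw [natDegree_pow, natDegree_X_sub_C, mul_one] at h2; subst h2; simp at hr

/-- For `d > 1` the derivative of the left side vanishes at `b`, and `e ≠ 0` in `K` forces `b = c`.
For `d = 1` the centres may differ. Either way `G` is a power of a linear polynomial. -/
theorem prime_step_linear {K : Type*} [Field K] {G : K[X]} {b c : K} {d e : ℕ}
    (hG : IsIndecomposable (algebraMap K[X] (RatFunc K) G)) (hd : d ≠ 0) (he : (e : K) ≠ 0)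
    (h : G.comp ((X - C b) ^ d) = (X - C c) ^ e) : ∃ n, n.Prime ∧ e = n * d := by
  have hdeg : G.natDegree * d = e := by
    have := congrArg natDegree h
    rwa [natDegree_comp, natDegree_pow, natDegree_pow, natDegree_X_sub_C, natDegree_X_sub_C,
      mul_one, mul_one] at this
  refine ⟨G.natDegree, ?_, hdeg.symm⟩
  obtain ⟨t, ht⟩ : ∃ t, G = (X - C t) ^ G.natDegree := by
    rcases eq_or_ne d 1 with rfl | hd1
    · refine ⟨c - b, eq_of_comp_eq (k := (X - C b) ^ 1) (by simp) ?_⟩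
      rw [h, pow_comp, sub_comp, Polynomial.X_comp, C_comp, ← hdeg, mul_one, C_sub]
      ring
    · have hbc : b = c := by
        have h1 := congrArg (fun p => eval b (derivative p)) h
        simp only [derivative_comp, derivative_X_sub_C_pow, eval_mul, eval_pow, eval_sub, eval_X,
          eval_C, sub_self] at h1
        rw [zero_pow (by omega), mul_zero, zero_mul] at h1
        have h2 := (mul_eq_zero.mp h1.symm).resolve_left (by simpa using he)
        exact sub_eq_zero.mp (eq_zero_of_pow_eq_zero h2)
      subst hbc
      refine ⟨0, eq_of_comp_eq (k := (X - C b) ^ d) (by simpa) ?_⟩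
      rw [h, C_0, sub_zero, X_pow_comp, ← pow_mul, mul_comm d, hdeg]
  rw [ht] at hG
  exact prime_of_isIndecomposable_pow hG

theorem prime_step_pow {K : Type*} [Field K] {G R : K[X]} {d e : ℕ}
    (hG : IsIndecomposable (algebraMap K[X] (RatFunc K) G)) (hR : R.natDegree ≠ 0) (hd : d ≠ 0)
    (h : G.comp (R ^ d) = R ^ e) : ∃ n, n.Prime ∧ e = n * d := by
  have hdeg : G.natDegree * d = e := by
    have := congrArg natDegree h
    rw [natDegree_comp, natDegree_pow, natDegree_pow, ← mul_assoc] at this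
    exact Nat.eq_of_mul_eq_mul_right (Nat.pos_of_ne_zero hR) this
  refine ⟨G.natDegree, ?_, hdeg.symm⟩
  have ht : G = (X - C 0) ^ G.natDegree := by
    refine eq_of_comp_eq (k := R ^ d) (by simpa using ⟨hd, hR⟩) ?_
    rw [h, C_0, sub_zero, X_pow_comp, ← pow_mul, mul_comm d, hdeg]
  rw [ht] at hG
  exact prime_of_isIndecomposable_pow hG

open ArithmeticFunction (cardFactors)

variable {F : Type*} [Field F] [Fintype F]

/-- By translation invariance `x^q - x = y(y^(q-1) - 1)` with `y = x - b`; its `d`-th power is a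
polynomial in `y^d`. -/
theorem X_pow_card_sub_X_pow_eq_comp (b : F) {d : ℕ} (hd : d ∣ Fintype.card F - 1) (n : ℕ) :
    (X ^ Fintype.card F - X : F[X]) ^ (d * n) =
      ((X ^ n : F[X]).comp (X * (X ^ ((Fintype.card F - 1) / d) - 1) ^ d)).comp ((X - C b) ^ d) := by
  have hq : Fintype.card F = Fintype.card F - 1 + 1 := (Nat.sub_add_cancel Fintype.card_pos).symm
  obtain ⟨p, hp⟩ := CharP.exists F
  obtain ⟨k, hpp, hk⟩ := FiniteField.card F p
  have : Fact p.Prime := ⟨hpp⟩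
  have hX : (X ^ Fintype.card F - X : F[X]) = (X - C b) ^ Fintype.card F - (X - C b) := by
    rw [hk, sub_pow_char_pow, ← C_pow, ← hk, FiniteField.pow_card]
    ring
  have hX' : (X ^ Fintype.card F - X : F[X]) =
      (X - C b) * ((X - C b) ^ (Fintype.card F - 1) - 1) := by
    rw [hX, mul_sub, mul_one, ← pow_succ', ← hq]
  simp only [pow_comp, mul_comp, sub_comp, Polynomial.X_comp, one_comp]
  rw [hX', ← pow_mul, Nat.mul_div_cancel' hd, pow_mul, mul_pow]

/-- Degrees and coprimality of `d` with `q` give `e = d * n`. Cancelling `(x - b)^d` shows `G = x^n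
∘ R` with `deg R = q`, so indecomposability forces `n = 1`. -/
theorem step_linear_to_translation {G : F[X]} {b : F} {d e : ℕ}
    (hG : IsIndecomposable (algebraMap F[X] (RatFunc F) G))
    (hq : (Fintype.card F).Prime) (hd : d ∣ Fintype.card F - 1) (he : e ∣ Fintype.card F - 1)
    (h : G.comp ((X - C b) ^ d) = (X ^ Fintype.card F - X) ^ e) : e = d := by
  have hq2 := hq.two_le
  have hd0 : d ≠ 0 := by rintro rfl; rw [zero_dvd_iff] at hd; omega
  have he0 : e ≠ 0 := by rintro rfl; rw [zero_dvd_iff] at he; omega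
  have hdeg : G.natDegree * d = e * Fintype.card F := by
    have := congrArg natDegree h
    rwa [natDegree_comp, natDegree_pow, natDegree_pow, natDegree_X_sub_C,
      natDegree_X_pow_card_sub_X, mul_one] at this
  have hcop : d.Coprime (Fintype.card F) := by
    refine ((Nat.Prime.coprime_iff_not_dvd hq).mpr fun h => ?_).symm
    have := Nat.le_of_dvd (by omega) (h.trans hd)
    omega
  obtain ⟨n, rfl⟩ : d ∣ e := hcop.dvd_of_dvd_mul_right ⟨_, by rw [← hdeg, mul_comm]⟩
  have hn0 : n ≠ 0 := by rintro rfl; simp at he0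
  set R : F[X] := X * (X ^ ((Fintype.card F - 1) / d) - 1) ^ d with hR
  have hGR : G = (X ^ n : F[X]).comp R :=
    eq_of_comp_eq (k := (X - C b) ^ d) (by simpa) (h.trans (X_pow_card_sub_X_pow_eq_comp b hd n))
  have hRdeg : R.natDegree = Fintype.card F := by
    have h1 := congrArg natDegree hGR
    rw [natDegree_comp, natDegree_X_pow] at h1
    rw [h1] at hdeg
    refine Nat.eq_of_mul_eq_mul_left (Nat.pos_of_ne_zero he0) ?_
    rw [← hdeg]; ring
  rw [hGR] at hG
  rcases natDegree_eq_one_or_of_isIndecomposable hG (by simpa) (by omega) with h1 | h1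
  · rw [natDegree_X_pow] at h1
    rw [h1, mul_one]
  · omega

theorem polyP_eq : polyP F =
    algebraMap F[X] (RatFunc F) ((X ^ Fintype.card F - X) ^ (Fintype.card F - 1)) := by
  simp [polyP]

/-- The shape and the length of a product of indecomposables that is a right component of
`(x^q - x)^(q-1)`, for `q` prime. -/
theorem right_component_length (hq : (Fintype.card F).Prime) (l : List (RatFunc F))
    (hl : ∀ g ∈ l, IsIndecomposable g) (a : RatFunc F) (ha : IsNonconst a)
    (hP : comp a (compList l) = polyP F) :
    ∃ (u v : RatFunc F) (k : F[X]) (d : ℕ), Inverses u v ∧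
      compList l = comp u (algebraMap F[X] (RatFunc F) k) ∧ d ∣ Fintype.card F - 1 ∧
      ((∃ b, k = (X - C b) ^ d) ∧ l.length = cardFactors d ∨
        k = (X ^ Fintype.card F - X) ^ d ∧ l.length = cardFactors d + 1) := by
  induction l generalizing a with
  | nil =>
    refine ⟨_, _, X, 1, Inverses.refl, ?_, one_dvd _, Or.inl ⟨⟨0, by simp⟩, by simp⟩⟩
    rw [RatFunc.algebraMap_X, comp_X]; rfl
  | cons g l ih =>
    have hq2 := hq.two_le
    have hg := hl g (by simp)
    have hl' : ∀ g ∈ l, IsIndecomposable g := fun x hx => hl x (by simp [hx])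
    have hlc : IsNonconst (compList l) := isNonconst_compList fun x hx => (hl' x hx).1
    have hcons : compList (g :: l) = comp g (compList l) := rfl
    rw [hcons] at hP ⊢
    obtain ⟨u', v', k', d', huv', hk', hd', hshape'⟩ :=
      ih hl' (comp a g) (ha.comp hg.1) (by rw [comp_assoc _ _ hlc, hP])
    rw [polyP_eq] at hP
    obtain ⟨u, v, A, H, huv, hH, -, hAH, -, hH0⟩ :=
      exists_polynomial_decomposition ha (hg.1.comp hlc) hP
    obtain ⟨U, d, hU, hd, hshape⟩ := right_component_classification hq hH0 hAH
    obtain ⟨k, hk, hshape⟩ : ∃ k, H = U.comp k ∧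
        ((∃ b, k = (X - C b) ^ d) ∨ k = (X ^ Fintype.card F - X) ^ d) := by
      rcases hshape with ⟨b, h⟩ | h
      exacts [⟨_, h, Or.inl ⟨b, rfl⟩⟩, ⟨_, h, Or.inr rfl⟩]
    obtain ⟨V, hV⟩ := isCompUnit_iff.mp (isCompUnit_algebraMap hU)
    have hW := huv.symm.comp hV
    set w := comp v (algebraMap F[X] (RatFunc F) U)
    set w' := comp V u
    have hk0 : k.natDegree ≠ 0 := fun h => hH0 (by rw [hk, natDegree_comp, h, mul_zero])
    have hkc := isNonconst_algebraMap hk0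
    have hf : comp g (compList l) = comp w (algebraMap F[X] (RatFunc F) k) := by
      rw [comp_assoc _ _ hkc, comp_algebraMap U, aeval_algebraMap_eq_comp, ← hk, ← hH,
        huv.symm.comp_cancel (hg.1.comp hlc)]
    have hd0 : d ≠ 0 := by rintro rfl; rw [zero_dvd_iff] at hd; omega
    have hd'0 : d' ≠ 0 := by rintro rfl; rw [zero_dvd_iff] at hd'; omega
    have hk'0 : k'.natDegree ≠ 0 := by
      rcases hshape' with ⟨⟨b, rfl⟩, -⟩ | ⟨rfl, -⟩
      · simpa
      · rw [natDegree_pow, natDegree_X_pow_card_sub_X]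
        exact mul_ne_zero hd'0 (by omega)
    have hk'c := isNonconst_algebraMap hk'0
    have hind := hg.conj hW.symm huv'
    -- Absorbing the units into `g` gives an indecomposable polynomial `G` with `G ∘ k' = k`, a step
    -- between two normalized shapes.
    have hcomp : comp (comp w' (comp g u')) (algebraMap F[X] (RatFunc F) k') =
        algebraMap F[X] (RatFunc F) k := by
      rw [comp_assoc _ _ hk'c, comp_assoc _ _ hk'c, ← hk', hf, hW.symm.comp_cancel hkc]
    obtain ⟨G, hG⟩ := exists_eq_algebraMap_of_comp_eq hk'0 hcomp
    rw [hG] at hind hcomp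
    rw [comp_algebraMap, aeval_algebraMap_eq_comp] at hcomp
    have hGk := RatFunc.algebraMap_injective F hcomp
    refine ⟨w, w', k, d, hW, hf, hd, ?_⟩
    have hlength : ∀ n, n.Prime → cardFactors (n * d') = cardFactors d' + 1 := fun n hn => by
      rw [ArithmeticFunction.cardFactors_mul hn.ne_zero hd'0,
        ArithmeticFunction.cardFactors_apply_prime hn, add_comm]
    rw [List.length_cons]
    rcases hshape' with ⟨⟨b, rfl⟩, hlen⟩ | ⟨rfl, hlen⟩
    · rcases hshape with ⟨c, rfl⟩ | rfl
      · obtain ⟨n, hn, rfl⟩ := prime_step_linear hind hd'0 (by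
          rw [Ne, natCast_eq_zero_iff_card_dvd hq]
          intro h
          have := Nat.le_of_dvd (by omega) (h.trans hd)
          omega) hGk
        exact Or.inl ⟨⟨c, rfl⟩, by rw [hlen, hlength n hn]⟩
      · obtain rfl := step_linear_to_translation hind hq hd' hd hGk
        exact Or.inr ⟨rfl, by rw [hlen]⟩
    · rcases hshape with ⟨c, rfl⟩ | rfl
      -- Returning from `(x^q - x)^d'` to `(x - c)^d` would make `q` divide `d`, hence `q - 1`.
      · exfalso
        have h1 := congrArg natDegree hGk
        rw [natDegree_comp, natDegree_pow, natDegree_pow, natDegree_X_sub_C,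
          natDegree_X_pow_card_sub_X, mul_one] at h1
        have h2 : Fintype.card F ∣ Fintype.card F - 1 :=
          (Dvd.intro_left (G.natDegree * d') (by rw [← h1]; ring)).trans hd
        have := Nat.le_of_dvd (by omega) h2
        omega
      · obtain ⟨n, hn, rfl⟩ := prime_step_pow hind
          (by rw [natDegree_X_pow_card_sub_X]; omega) hd'0 hGk
        exact Or.inr ⟨rfl, by rw [hlen, hlength n hn]⟩

theorem length_of_card_prime (hq : (Fintype.card F).Prime) {l : List (RatFunc F)}
    (hl : IsCompleteDecomposition (polyP F) l) :
    l.length = cardFactors (Fintype.card F - 1) + 1 := by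
  have hq2 := hq.two_le
  obtain ⟨u, v, k, d, huv, hk, hd, hshape⟩ := right_component_length hq l hl.1 RatFunc.X
    isNonconst_X (by rw [X_comp, ← hl.2])
  have hd0 : d ≠ 0 := by rintro rfl; rw [zero_dvd_iff] at hd; omega
  have hk0 : k.natDegree ≠ 0 := by
    rcases hshape with ⟨⟨b, rfl⟩, -⟩ | ⟨rfl, -⟩
    · simpa
    · rw [natDegree_pow, natDegree_X_pow_card_sub_X]
      exact mul_ne_zero hd0 (by omega)
  rw [← hl.2, polyP_eq] at hk
  obtain ⟨U, rfl⟩ := exists_eq_algebraMap_of_comp_eq hk0 hk.symm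
  rw [comp_algebraMap, aeval_algebraMap_eq_comp] at hk
  have h1 := congrArg natDegree (RatFunc.algebraMap_injective F hk)
  rw [natDegree_comp, natDegree_eq_one_of_isCompUnit huv.isCompUnit, one_mul, natDegree_pow,
    natDegree_X_pow_card_sub_X] at h1
  -- The normalized shape has degree `(q - 1) * q`: too large for `(x - b)^d`, and forcing `d = q -
  -- 1` in the other family.
  rcases hshape with ⟨⟨b, rfl⟩, -⟩ | ⟨rfl, hlen⟩
  · rw [natDegree_pow, natDegree_X_sub_C, mul_one] at h1
    have h2 := Nat.le_of_dvd (by omega) hd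
    have h3 : (Fintype.card F - 1) * 2 ≤ (Fintype.card F - 1) * Fintype.card F :=
      Nat.mul_le_mul_left _ hq2
    omega
  · rw [natDegree_pow, natDegree_X_pow_card_sub_X] at h1
    rw [hlen, ← Nat.eq_of_mul_eq_mul_right (by omega) h1]

end PrimeCard

/-! ### Two decompositions of different lengths for `q` not prime -/

section NonPrimeCard

/-- In a nontrivial `G ∘ H`, put `t = H(0)` and remove the simple root `0`: with `G = (x - t)G₁` and
`H - t = xH₁`, one gets `H₁ * (G₁ ∘ H) = (x - 1)^m`. Both factors are nonconstant, so vanish at `1`;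
then `H(1) = t = H(0)` makes `G₁ ∘ H` vanish at `0` too, which is absurd. -/
theorem isIndecomposable_X_mul_X_sub_one_pow {K : Type*} [Field K] {m : ℕ} (hm : m ≠ 0) :
    IsIndecomposable (algebraMap K[X] (RatFunc K) (X * (X - 1) ^ m)) := by
  have hX1 : (X - 1 : K[X]) = X - C 1 := by rw [C_1]
  have hdeg : (X * (X - 1) ^ m : K[X]).natDegree = m + 1 := by
    rw [hX1, natDegree_mul X_ne_zero (pow_ne_zero _ (X_sub_C_ne_zero _)), natDegree_pow,
      natDegree_X_sub_C, natDegree_X]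
    ring
  refine isIndecomposable_of_polynomial (by omega) fun G H e => ?_
  have hmul : G.natDegree * H.natDegree = m + 1 := by rw [← natDegree_comp, e, hdeg]
  by_contra! hne
  have hG0 : G.natDegree ≠ 0 := by intro h; rw [h] at hmul; omega
  have hH0 : H.natDegree ≠ 0 := by intro h; rw [h] at hmul; omega
  set t := H.eval 0 with ht
  obtain ⟨G₁, hG₁⟩ : X - C t ∣ G := dvd_iff_isRoot.mpr (by
    rw [IsRoot.def, ht, ← eval_comp, e]; simp)
  obtain ⟨H₁, hH₁⟩ : X ∣ H - C t := by
    rw [X_dvd_iff, coeff_zero_eq_eval_zero]; simp [ht]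
  have hprod : H₁ * G₁.comp H = (X - C 1) ^ m := by
    have h1 : X * (H₁ * G₁.comp H) = X * (X - 1) ^ m := by
      rw [← e, hG₁, mul_comp, sub_comp, Polynomial.X_comp, C_comp, hH₁, mul_assoc]
    rw [← hX1]
    exact mul_left_cancel₀ X_ne_zero h1
  have hroot : ∀ A : K[X], A ∣ (X - C 1) ^ m → A.natDegree ≠ 0 → A.eval 1 = 0 := by
    intro A hA hA0
    obtain ⟨i, -, hi⟩ := (dvd_prime_pow (prime_X_sub_C (1 : K)) m).mp hA
    have hi0 : i ≠ 0 := by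
      rintro rfl
      rw [pow_zero, associated_one_iff_isUnit] at hi
      exact hA0 (natDegree_eq_zero_of_isUnit hi)
    exact dvd_iff_isRoot.mp ((dvd_pow_self _ hi0).trans hi.symm.dvd)
  have hH₁deg : H₁.natDegree ≠ 0 := by
    have h1 := congrArg natDegree hH₁
    rw [natDegree_sub_C] at h1
    intro h2
    have := (natDegree_mul_le (p := (X : K[X])) (q := H₁))
    rw [natDegree_X] at this
    omega
  have hG₁deg : (G₁.comp H).natDegree ≠ 0 := by
    rw [natDegree_comp]
    refine mul_ne_zero (fun h2 => ?_) hH0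
    have := (natDegree_mul_le (p := X - C t) (q := G₁))
    rw [natDegree_X_sub_C, ← hG₁] at this
    omega
  have h1 : H.eval 1 = t := by
    have := congrArg (eval 1) hH₁
    rw [eval_mul, hroot H₁ ⟨_, hprod.symm⟩ hH₁deg, mul_zero, eval_sub, eval_C] at this
    exact sub_eq_zero.mp this
  have h2 := hroot _ ⟨_, by rw [mul_comm, hprod]⟩ hG₁deg
  rw [eval_comp, h1, ht, ← eval_comp] at h2
  have h3 := congrArg (eval 0) hprod
  rw [eval_mul, h2, mul_zero] at h3
  simp only [eval_pow, eval_sub, eval_X, eval_C, zero_sub] at h3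
  exact pow_ne_zero m (neg_ne_zero.mpr one_ne_zero) h3.symm

variable {F : Type*} [Field F] [Fintype F]

/-- If `q` is not prime, then `x^q - x` is the composite of a trace polynomial and `x^p - x`. -/
theorem exists_comp_eq_X_pow_card_sub_X (hq : ¬ (Fintype.card F).Prime) :
    ∃ A B : F[X], 2 ≤ A.natDegree ∧ 2 ≤ B.natDegree ∧ A.comp B = X ^ Fintype.card F - X := by
  obtain ⟨p, hp⟩ := CharP.exists F
  obtain ⟨k, hpp, hk⟩ := FiniteField.card F p
  have : Fact p.Prime := ⟨hpp⟩
  have hp2 := hpp.two_le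
  have hk2 : 2 ≤ (k : ℕ) := by
    have := k.pos
    by_contra h
    have h1 : (k : ℕ) = 1 := by omega
    rw [h1, pow_one] at hk
    exact hq (hk ▸ hpp)
  have e : (∑ i ∈ Finset.range k, X ^ p ^ i : F[X]).comp (X ^ p - X) = X ^ Fintype.card F - X := by
    rw [← coe_compRingHom_apply, map_sum]
    simp only [coe_compRingHom_apply]
    have : ∀ i ∈ Finset.range k, (X ^ p ^ i : F[X]).comp (X ^ p - X) =
        X ^ p ^ (i + 1) - X ^ p ^ i := fun i _ => by
      rw [X_pow_comp, sub_pow_char_pow, ← pow_mul, ← pow_succ']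
    -- The trace polynomial applied to `x^p - x` telescopes to `x^(p^k) - x`.
    rw [Finset.sum_congr rfl this, Finset.sum_range_sub (fun i => (X ^ p ^ i : F[X])), ← hk]
    simp
  have hB : (X ^ p - X : F[X]).natDegree = p :=
    FiniteField.X_pow_card_sub_X_natDegree_eq F hpp.one_lt
  refine ⟨_, _, ?_, by omega, e⟩
  have h1 := congrArg natDegree e
  rw [natDegree_comp, hB, natDegree_X_pow_card_sub_X, hk] at h1
  by_contra h
  have h2 : p ^ 2 ≤ p ^ (k : ℕ) := Nat.pow_le_pow_right (by omega) hk2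
  have h3 : p ^ (k : ℕ) ≤ 1 * p := by
    rw [← h1]
    exact Nat.mul_le_mul_right _ (by omega)
  nlinarith

theorem exists_length_ne_of_card_not_prime (hq : ¬ (Fintype.card F).Prime) :
    ∃ l₁ l₂ : List (RatFunc F), IsCompleteDecomposition (polyP F) l₁ ∧
      IsCompleteDecomposition (polyP F) l₂ ∧ l₁.length ≠ l₂.length := by
  obtain ⟨A, B, hA, hB, hAB⟩ := exists_comp_eq_X_pow_card_sub_X (F := F) hq
  have hq3 : 3 ≤ Fintype.card F := by
    have h1 : 1 < Fintype.card F := Fintype.one_lt_card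
    by_contra h
    exact hq (by rw [show Fintype.card F = 2 by omega]; exact Nat.prime_two)
  obtain ⟨l₀, h₀, -⟩ := exists_isCompleteDecomposition
    (P := (X ^ (Fintype.card F - 1) : F[X])) (by rw [natDegree_X_pow]; omega)
  obtain ⟨lA, hlA, hA0⟩ := exists_isCompleteDecomposition hA
  obtain ⟨lB, hlB, hB0⟩ := exists_isCompleteDecomposition hB
  have hR := (isIndecomposable_X_mul_X_sub_one_pow (K := F)
    (m := Fintype.card F - 1) (by omega)).isCompleteDecomposition
  have h₁ := hR.append h₀
  have hP : comp (algebraMap F[X] (RatFunc F) (X * (X - 1) ^ (Fintype.card F - 1)))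
      (algebraMap F[X] (RatFunc F) (X ^ (Fintype.card F - 1))) = polyP F := by
    have e := X_pow_card_sub_X_pow_eq_comp (0 : F) (dvd_refl (Fintype.card F - 1)) 1
    rw [Nat.div_self (by omega)] at e
    simp only [mul_one, pow_one, Polynomial.X_comp, C_0, sub_zero] at e
    rw [comp_algebraMap, aeval_algebraMap_eq_comp, ← e, polyP_eq]
  rw [hP] at h₁
  have h₂ : IsCompleteDecomposition (polyP F) (l₀ ++ (lA ++ lB)) := by
    have := h₀.append (hlA.append hlB)
    rwa [comp_algebraMap A, aeval_algebraMap_eq_comp, hAB, comp_algebraMap,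
      aeval_algebraMap_eq_comp, X_pow_comp, ← polyP_eq] at this
  -- Both lists share `l₀`; besides it the first has one component and the second at least two.
  refine ⟨_, _, h₁, h₂, ?_⟩
  have h1 := List.length_pos_iff.mpr hA0
  have h2 := List.length_pos_iff.mpr hB0
  simp only [List.length_append, List.length_singleton]
  omega

end NonPrimeCard
end RatDecomp

theorem mainTheorem1 (F : Type*) [Field F] [Fintype F] :
    ((∃ l₁ l₂ : List (RatFunc F),
        RatDecomp.IsCompleteDecomposition (RatDecomp.polyP F) l₁ ∧
        RatDecomp.IsCompleteDecomposition (RatDecomp.polyP F) l₂ ∧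
        l₁.length ≠ l₂.length) ↔
      ¬ (Fintype.card F).Prime) ∧
    ((Fintype.card F).Prime →
      ∀ l : List (RatFunc F), RatDecomp.IsCompleteDecomposition (RatDecomp.polyP F) l →
        l.length = ArithmeticFunction.cardFactors (Fintype.card F - 1) + 1) := by
  refine ⟨⟨?_, RatDecomp.exists_length_ne_of_card_not_prime⟩,
    fun hq l hl => RatDecomp.length_of_card_prime hq hl⟩
  rintro ⟨l₁, l₂, h₁, h₂, hne⟩ hq
  exact hne ((RatDecomp.length_of_card_prime hq h₁).trans
    (RatDecomp.length_of_card_prime hq h₂).symm)
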